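/- For integers $k,m\ge 0$ let $\mathcal R(k,m)$ be the set of real rational functions $r=P/Q$ with real polynomials $P,Q$, $\deg P\le k$, $\deg Q\le m$, $Q$ monic. For $\alpha\in(0,1)$ let $$E_{\alpha,k,m}:=\inf_{r\in\mathcal R(k,m)}\bigl\|t^{1-\alpha}-r(t)\bigr\|_{L^\infty(0,1)} .$$ Let $\alpha\in(0,1)$, let $k\ge 1$ be an integer, and let $r_\alpha\in\mathcal R(k,k)$ be a best uniform rational approximation of $t^{1-\alpha}$ on $[0,1]$, that is, an element of $\mathcal R(k,k)$ with $\|t^{1-\alpha}-r_\alpha(t)\|_{L^\infty(0,1)}=E_{\alpha,k,k}$. Then: (a) $r_\alpha$ is strictly increasing and concave on $[0,1]$; (b) $r_\alpha(0)=E_{\alpha,k,k}$. -/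

import Mathlib

open scoped Polynomial

namespace BURA

noncomputable section

/-- The class `R(k, m)`: real rational functions that can be written as `P / Q` with
`deg P ≤ k`, `deg Q ≤ m` and `Q` monic. -/
def ratClass (k m : ℕ) : Set (RatFunc ℝ) :=
  {r | ∃ P Q : ℝ[X], P.natDegree ≤ k ∧ Q.natDegree ≤ m ∧ Q.Monic ∧
    r = algebraMap ℝ[X] (RatFunc ℝ) P / algebraMap ℝ[X] (RatFunc ℝ) Q}

/-- The value at `t` of a rational function: that of its reduced fraction, so that a common
zero of `P` and `Q` is not by itself a pole. At an actual pole the value is `0` by convention;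
these are finitely many points, near which the function is unbounded. -/
def ratEval (r : RatFunc ℝ) (t : ℝ) : ℝ :=
  r.eval (RingHom.id ℝ) t

/-- The error `‖t ^ (1 - α) - r(t)‖` in `L^∞(0, 1)`, with values in `[0, ∞]`; it is infinite
when `r` has a pole in `[0, 1]`. -/
def uniformError (α : ℝ) (r : RatFunc ℝ) : ENNReal :=
  MeasureTheory.eLpNorm (fun t : ℝ => t ^ (1 - α) - ratEval r t) ⊤
    (MeasureTheory.volume.restrict (Set.Ioo 0 1))

/-- `r` is a best uniform rational approximation of `t ^ (1 - α)` on `[0, 1]` in `R(k, m)`. -/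
def IsBURA (α : ℝ) (k m : ℕ) (r : RatFunc ℝ) : Prop :=
  r ∈ ratClass k m ∧ ∀ s ∈ ratClass k m, uniformError α r ≤ uniformError α s

/-- The minimax error `E_{α,k,m}`, i.e. the least uniform error over `R(k, m)`. It is the
error of every best approximation, and it is finite for `α < 1` because of `r = 0`. -/
def minimaxError (α : ℝ) (k m : ℕ) : ℝ :=
  (⨅ r ∈ ratClass k m, uniformError α r).toReal

end

end BURA

/-! Put `β = 1 - α`. Since `t ^ β` is a positive multiple of the integral of `s ^ (β - 1) * t / (s +
t)` over `s > 0`, the divided difference of `h(t) t ^ β` at positive nodes is an integral of `h(-s)`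
against a kernel of fixed sign. So its sign is known when `h` is nonnegative on the negative axis
(`pow_mul_sum_nodalWeight_rpow_pos`).

If `q t ^ β = p` at the nodes, then `u q t ^ β` and `u p` have the same divided difference there,
and that of `u p` vanishes when the degree is low. Different `u` show that `t ^ β` has no rational
interpolant of degree `n` at `2n + 2` positive points, and that an interpolant of degree `k` at `2k
+ 1` points has `k` simple negative poles with negative residues. Such a function is increasing and
concave.

The error of a best approximation equioscillates (`exists_alternation`). Zero counting excludes a
defect, so there are `2k + 2` extremal points and hence `2k + 1` interpolation points. One more
count makes `0` extremal. The error there is not `+E`, since `t ^ β` would then grow at most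
linearly at `0`. -/

namespace BURA

open Polynomial Set MeasureTheory Filter Topology

/-! ### Divided differences of `t ^ β` times a polynomial. -/

/-- Divided differences over a node set annihilate polynomials of degree at most `#Z - 2`. -/
lemma sum_nodalWeight_eval_eq_zero (Z : Finset ℝ) (g : ℝ[X]) (hg : g.natDegree + 2 ≤ Z.card) :
    ∑ z ∈ Z, Lagrange.nodalWeight Z id z * g.eval z = 0 := by
  have hlt : g.degree < Z.card :=
    lt_of_le_of_lt degree_le_natDegree (by exact_mod_cast (by omega : g.natDegree < Z.card))
  have h := Lagrange.coeff_eq_sum (s := Z) (v := id) (Set.injOn_id _) hlt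
  rw [coeff_eq_zero_of_natDegree_lt (by omega)] at h
  rw [h]
  refine Finset.sum_congr rfl fun z _ => ?_
  simp [Lagrange.nodalWeight, div_eq_mul_inv, mul_comm]

/-- The partial fraction decomposition of `g / ∏ (X - z)` at a point off the nodes. -/
lemma eval_eq_prod_mul_sum (Z : Finset ℝ) (g : ℝ[X]) (hg : g.natDegree < Z.card) (x : ℝ)
    (hx : ∀ z ∈ Z, x ≠ z) :
    g.eval x = (∏ z ∈ Z, (x - z)) *
      ∑ z ∈ Z, Lagrange.nodalWeight Z id z * (x - z)⁻¹ * g.eval z := by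
  have hlt : g.degree < Z.card :=
    lt_of_le_of_lt degree_le_natDegree (by exact_mod_cast hg)
  have h := Lagrange.eq_interpolate (s := Z) (v := id) (Set.injOn_id _) hlt
  have h2 := Lagrange.eval_interpolate_not_at_node (s := Z) (v := id)
    (fun z => g.eval (id z)) (x := x) hx
  rw [← h, Lagrange.eval_nodal] at h2
  simpa using h2

/-- The partial fraction decomposition at a negative point, with positive nodes. -/
lemma sum_nodalWeight_div_add (Z : Finset ℝ) (hZ : ∀ z ∈ Z, 0 < z) (g : ℝ[X])
    (hg : g.natDegree < Z.card) {s : ℝ} (hs : 0 < s) :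
    (-1) ^ Z.card * ∑ z ∈ Z, Lagrange.nodalWeight Z id z * (g.eval z / (s + z)) =
      - (g.eval (-s) / ∏ z ∈ Z, (s + z)) := by
  have h := eval_eq_prod_mul_sum Z g hg (-s) (fun z hz => by have := hZ z hz; linarith)
  have hP : ∏ z ∈ Z, (s + z) ≠ 0 :=
    (Finset.prod_pos fun z hz => by have := hZ z hz; linarith).ne'
  have h1 : ∏ z ∈ Z, (-s - z) = (-1) ^ Z.card * ∏ z ∈ Z, (s + z) := by
    rw [← Finset.prod_const, ← Finset.prod_mul_distrib]
    exact Finset.prod_congr rfl fun z _ => by ring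
  have h2 : ∑ z ∈ Z, Lagrange.nodalWeight Z id z * (-s - z)⁻¹ * g.eval z =
      - ∑ z ∈ Z, Lagrange.nodalWeight Z id z * (g.eval z / (s + z)) := by
    rw [← Finset.sum_neg_distrib]
    refine Finset.sum_congr rfl fun z _ => ?_
    rw [show -s - z = -(s + z) by ring, inv_neg]
    ring
  rw [h, h1, h2]
  field_simp

lemma rpow_sum_eq_integral {β : ℝ} (hβ : β ∈ Ioo (0 : ℝ) 1) (Z : Finset ℝ)
    (hZ : ∀ z ∈ Z, 0 < z) (c : ℝ → ℝ) :
    IntegrableOn (fun s => ∑ z ∈ Z, c z * Real.rpowIntegrand₀₁ β s z) (Ioi 0) ∧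
    ∑ z ∈ Z, c z * z ^ β = (∫ s in Ioi 0, Real.rpowIntegrand₀₁ β s 1)⁻¹ *
      ∫ s in Ioi 0, ∑ z ∈ Z, c z * Real.rpowIntegrand₀₁ β s z := by
  have hi : ∀ z ∈ Z, IntegrableOn (fun s => c z * Real.rpowIntegrand₀₁ β s z) (Ioi 0) :=
    fun z hz => (Real.integrableOn_rpowIntegrand₀₁_Ioi hβ (hZ z hz).le).const_mul _
  refine ⟨integrable_finsetSum _ hi, ?_⟩
  rw [integral_finsetSum _ hi, Finset.mul_sum]
  refine Finset.sum_congr rfl fun z hz => ?_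
  rw [integral_const_mul, Real.rpow_eq_const_mul_integral hβ (hZ z hz).le]
  ring

/-- The divided difference of `h(t) t ^ β` has a definite sign whenever the polynomial `h` is
nonnegative on the negative axis. -/
lemma pow_mul_sum_nodalWeight_rpow_pos {β : ℝ} (hβ : β ∈ Ioo (0 : ℝ) 1) (Z : Finset ℝ)
    (hZ : ∀ z ∈ Z, 0 < z) (h : ℝ[X]) (hdeg : h.natDegree + 2 ≤ Z.card) (h0 : h ≠ 0)
    (hnn : ∀ x < 0, 0 ≤ h.eval x) :
    0 < (-1) ^ Z.card * ∑ z ∈ Z, Lagrange.nodalWeight Z id z * (h.eval z * z ^ β) := by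
  obtain ⟨hint, heq⟩ := rpow_sum_eq_integral hβ Z hZ
    (fun z => (-1) ^ Z.card * (Lagrange.nodalWeight Z id z * h.eval z))
  have hD : ∀ s ∈ Ioi (0 : ℝ), 0 < ∏ z ∈ Z, (s + z) := fun s hs =>
    Finset.prod_pos fun z hz => add_pos hs (hZ z hz)
  have hker : ∀ s ∈ Ioi (0 : ℝ), ∑ z ∈ Z, (-1) ^ Z.card *
      (Lagrange.nodalWeight Z id z * h.eval z) * Real.rpowIntegrand₀₁ β s z =
      s ^ β * (h.eval (-s) / ∏ z ∈ Z, (s + z)) := by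
    intro s hs
    have hs' : (0 : ℝ) < s := hs
    -- The factor `t` of the kernel `s ^ (β - 1) * t / (s + t)` is absorbed into the polynomial.
    -- This costs one degree, and its value `-s` at the pole cancels the minus sign of the partial
    -- fraction formula.
    have hdX : (X * h).natDegree < Z.card := by
      rw [natDegree_X_mul h0]; omega
    have key := sum_nodalWeight_div_add Z hZ (X * h) hdX hs'
    simp only [eval_mul, eval_X] at key
    have : s ^ β = s ^ (β - 1) * s := by
      rw [Real.rpow_sub_one hs'.ne']; field_simp
    rw [this, mul_assoc, show s * (h.eval (-s) / ∏ z ∈ Z, (s + z)) =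
      -(-s * h.eval (-s) / ∏ z ∈ Z, (s + z)) by ring, ← key, Finset.mul_sum, Finset.mul_sum]
    refine Finset.sum_congr rfl fun z hz => ?_
    rw [Real.rpowIntegrand₀₁_eq_pow_div hβ hs'.le (hZ z hz).le]
    ring
  have hpos : 0 < ∫ s in Ioi 0, ∑ z ∈ Z, (-1) ^ Z.card *
      (Lagrange.nodalWeight Z id z * h.eval z) * Real.rpowIntegrand₀₁ β s z := by
    rw [setIntegral_pos_iff_support_of_nonneg_ae _ hint]
    -- The integrand vanishes at most at the finitely many reflected roots of `h`.
    · have hsub : Ioi (0 : ℝ) \ ((fun x => -x) '' (h.rootSet ℝ)) ⊆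
          (Function.support fun s => ∑ z ∈ Z, (-1) ^ Z.card *
          (Lagrange.nodalWeight Z id z * h.eval z) * Real.rpowIntegrand₀₁ β s z) ∩ Ioi 0 := by
        rintro s ⟨hs, hr⟩
        refine ⟨?_, hs⟩
        rw [Function.mem_support, hker s hs]
        refine mul_ne_zero (Real.rpow_pos_of_pos hs _).ne' (div_ne_zero ?_ (hD s hs).ne')
        intro h1
        exact hr ⟨-s, by rw [mem_rootSet]; exact ⟨h0, by simpa [aeval_def] using h1⟩, by simp⟩
      refine lt_of_lt_of_le ?_ (measure_mono hsub)
      rw [measure_sdiff_null (((h.rootSet_finite ℝ).image _).measure_zero _)]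
      simp
    · refine (ae_restrict_iff' measurableSet_Ioi).2 (Filter.Eventually.of_forall fun s hs => ?_)
      simp only [Pi.zero_apply]
      rw [hker s hs]
      have hs' : (0 : ℝ) < s := hs
      exact mul_nonneg (Real.rpow_nonneg hs'.le _)
        (div_nonneg (hnn _ (by linarith)) (hD s hs).le)
  have hC := Real.integral_rpowIntegrand₀₁_one_pos hβ
  calc 0 < _ := mul_pos (inv_pos.2 hC) hpos
    _ = _ := by
      rw [← heq, Finset.mul_sum]
      exact Finset.sum_congr rfl fun z _ => by ring

/-- The system `1, …, t ^ n, t ^ β, …, t ^ (n + β)` is a Chebyshev system on the positive axis. -/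
lemma eq_zero_of_rpow_interpolation {β : ℝ} (hβ : β ∈ Ioo (0 : ℝ) 1) (Z : Finset ℝ)
    (hZ : ∀ z ∈ Z, 0 < z) {n : ℕ} {p q : ℝ[X]} (hp : p.natDegree ≤ n) (hq : q.natDegree ≤ n)
    (hn : 2 * n + 2 ≤ Z.card) (h : ∀ z ∈ Z, q.eval z * z ^ β = p.eval z) : q = 0 := by
  by_contra hq0
  have hdeg : (q * q).natDegree + 2 ≤ Z.card := by
    have := natDegree_mul_le (p := q) (q := q); omega
  have hdeg' : (q * p).natDegree + 2 ≤ Z.card := by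
    have := natDegree_mul_le (p := q) (q := p); omega
  have h1 := pow_mul_sum_nodalWeight_rpow_pos hβ Z hZ (q * q) hdeg (mul_ne_zero hq0 hq0)
    (fun x _ => by rw [eval_mul]; exact mul_self_nonneg _)
  have h2 := sum_nodalWeight_eval_eq_zero Z (q * p) hdeg'
  have h3 : ∑ z ∈ Z, Lagrange.nodalWeight Z id z * ((q * q).eval z * z ^ β) = 0 := by
    rw [← h2]
    refine Finset.sum_congr rfl fun z hz => ?_
    rw [eval_mul, eval_mul, mul_assoc (q.eval z), h z hz]
  rw [h3, mul_zero] at h1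
  exact lt_irrefl _ h1

/-! ### Poles and residues of rational interpolants of `t ^ β`. -/

/-- A factor of the denominator of an interpolant of `t ^ β` with small cofactor cannot be
nonnegative on the negative axis. -/
lemma not_nonneg_factor {β : ℝ} (hβ : β ∈ Ioo (0 : ℝ) 1) (Z : Finset ℝ)
    (hZ : ∀ z ∈ Z, 0 < z) {k : ℕ} {p q : ℝ[X]} (hp : p.natDegree ≤ k) (hq : q.natDegree ≤ k)
    (hq0 : q ≠ 0) (hk : Z.card = 2 * k + 1) (h : ∀ z ∈ Z, q.eval z * z ^ β = p.eval z)
    {g u : ℝ[X]} (hgu : q = g * u) (hu : u.natDegree + 1 ≤ k) (hg : ∀ x < 0, 0 ≤ g.eval x) :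
    False := by
  have hdeg : (u * q).natDegree + 2 ≤ Z.card := by
    have := natDegree_mul_le (p := u) (q := q); omega
  have hdeg' : (u * p).natDegree + 2 ≤ Z.card := by
    have := natDegree_mul_le (p := u) (q := p); omega
  have hu0 : u ≠ 0 := by rintro rfl; simp [hgu] at hq0
  -- The test polynomial is `u q = g u ^ 2`; its degree is at most `2k - 1`, just within the bound
  -- for `2k + 1` nodes.
  have h1 := pow_mul_sum_nodalWeight_rpow_pos hβ Z hZ (u * q) hdeg (mul_ne_zero hu0 hq0)
    (fun x hx => by
      rw [hgu, eval_mul, eval_mul, show u.eval x * (g.eval x * u.eval x) =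
        g.eval x * (u.eval x * u.eval x) by ring]
      exact mul_nonneg (hg x hx) (mul_self_nonneg _))
  have h2 := sum_nodalWeight_eval_eq_zero Z (u * p) hdeg'
  have h3 : ∑ z ∈ Z, Lagrange.nodalWeight Z id z * ((u * q).eval z * z ^ β) = 0 := by
    rw [← h2]
    refine Finset.sum_congr rfl fun z hz => ?_
    rw [eval_mul, eval_mul, mul_assoc (u.eval z), h z hz]
  rw [h3, mul_zero] at h1
  exact lt_irrefl _ h1

lemma nonneg_or_nonpos_of_roots_eq_zero {g : ℝ[X]} (hg0 : g ≠ 0) (hg : g.roots = 0) :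
    (∀ x, 0 ≤ g.eval x) ∨ (∀ x, g.eval x ≤ 0) := by
  by_contra hcon
  push Not at hcon
  obtain ⟨⟨x, hx⟩, ⟨y, hy⟩⟩ := hcon
  obtain ⟨z, hz⟩ := mem_range_of_exists_le_of_exists_ge (c := 0)
    g.continuous ⟨x, hx.le⟩ ⟨y, hy.le⟩
  have : z ∈ g.roots := (mem_roots hg0).2 hz
  rw [hg] at this
  simp at this

/-- The denominator of a rational interpolant of `t ^ β` at `2 k + 1` positive points has `k`
simple negative zeros. -/
lemma denom_eq_nodal {β : ℝ} (hβ : β ∈ Ioo (0 : ℝ) 1) (Z : Finset ℝ)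
    (hZ : ∀ z ∈ Z, 0 < z) {k : ℕ} {p q : ℝ[X]} (hp : p.natDegree ≤ k) (hq : q.natDegree ≤ k)
    (hq1 : q.Monic) (hk : Z.card = 2 * k + 1) (h : ∀ z ∈ Z, q.eval z * z ^ β = p.eval z) :
    ∃ R : Finset ℝ, R.card = k ∧ (∀ x ∈ R, x < 0) ∧ q = Lagrange.nodal R id := by
  have hq0 := hq1.ne_zero
  have main : ∀ g u : ℝ[X], q = g * u → u.natDegree + 1 ≤ k →
      (∀ x < 0, 0 ≤ g.eval x) → False :=
    fun g u => not_nonneg_factor hβ Z hZ hp hq hq0 hk h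
  have main' : ∀ g u : ℝ[X], q = g * u → u.natDegree + 1 ≤ k →
      (∀ x < 0, g.eval x ≤ 0) → False := fun g u hgu hu hg =>
    main (-g) (-u) (by rw [hgu]; ring) (by simpa using hu)
      (fun x hx => by simpa using hg x hx)
  have hdq : q.natDegree = k := by
    by_contra hne
    exact main 1 q (by simp) (by omega) (by simp)
  have hneg : ∀ a ∈ q.roots, a < 0 := by
    intro a ha
    by_contra! hle
    obtain ⟨u, hu⟩ := dvd_iff_isRoot.2 (isRoot_of_mem_roots ha)
    have hu0 : u ≠ 0 := by rintro rfl; simp [hu] at hq0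
    refine main' _ u hu ?_ fun x hx => ?_
    · have h1 := congrArg natDegree hu
      rw [natDegree_mul (X_sub_C_ne_zero a) hu0, natDegree_X_sub_C] at h1
      omega
    · simp only [eval_sub, eval_X, eval_C]; linarith
  have hnd : q.roots.Nodup := by
    rw [Multiset.nodup_iff_count_le_one]
    intro a
    by_contra! hlt
    rw [count_roots] at hlt
    obtain ⟨u, hu⟩ := (le_rootMultiplicity_iff hq0).1 hlt
    have hu0 : u ≠ 0 := by rintro rfl; simp [hu] at hq0
    refine main _ u hu ?_ fun x hx => ?_
    · have h1 := congrArg natDegree hu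
      rw [natDegree_mul (pow_ne_zero _ (X_sub_C_ne_zero a)) hu0, natDegree_pow,
        natDegree_X_sub_C] at h1
      omega
    · simp only [eval_pow]
      exact even_two.pow_nonneg _
  obtain ⟨g, hg, hcard, hgr⟩ := exists_prod_multiset_X_sub_C_mul q
  have hg0 : g ≠ 0 := by rintro rfl; exact hq0 (by rw [← hg, mul_zero])
  -- A factor without real roots has constant sign, so it is excluded like the others unless it is
  -- constant.
  have hgd : g.natDegree = 0 := by
    by_contra hne
    have hd : ((q.roots.map fun a => X - C a).prod).natDegree + 1 ≤ k := by
      rw [natDegree_multiset_prod_X_sub_C_eq_card]; omega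
    rcases nonneg_or_nonpos_of_roots_eq_zero hg0 hgr with hs | hs
    · exact main g _ (by rw [mul_comm]; exact hg.symm) hd fun x _ => hs x
    · exact main' g _ (by rw [mul_comm]; exact hg.symm) hd fun x _ => hs x
  have hg1 : g = 1 := by
    have hm : (q.roots.map fun a => X - C a).prod.Monic := monic_multisetProd_X_sub_C _
    exact (hm.of_mul_monic_left (by rw [hg]; exact hq1)).natDegree_eq_zero.1 hgd
  refine ⟨q.roots.toFinset, ?_, fun x hx => hneg x (Multiset.mem_toFinset.1 hx), ?_⟩
  · rw [Multiset.toFinset_card_of_nodup hnd]; omega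
  · rw [hg1, mul_one] at hg
    rw [Lagrange.nodal_eq, Finset.prod, Multiset.toFinset_val, Multiset.dedup_eq_self.2 hnd]
    exact hg.symm

/-- A rational interpolant of `t ^ β` at `2 k + 1` positive points is a constant minus a positive
combination of simple fractions with negative poles. -/
lemma exists_partial_fractions {β : ℝ} (hβ : β ∈ Ioo (0 : ℝ) 1) (Z : Finset ℝ)
    (hZ : ∀ z ∈ Z, 0 < z) {k : ℕ} {p q : ℝ[X]} (hp : p.natDegree ≤ k) (hq : q.natDegree ≤ k)
    (hq1 : q.Monic) (hk1 : 1 ≤ k) (hk : Z.card = 2 * k + 1)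
    (h : ∀ z ∈ Z, q.eval z * z ^ β = p.eval z) :
    ∃ (R : Finset ℝ) (c : ℝ) (a : ℝ → ℝ), R.Nonempty ∧ (∀ x ∈ R, x < 0) ∧ (∀ x ∈ R, 0 < a x) ∧
      ∀ t, 0 ≤ t → p.eval t / q.eval t = c - ∑ x ∈ R, a x / (t - x) := by
  obtain ⟨R, hR, hneg, hqR⟩ := denom_eq_nodal hβ Z hZ hp hq hq1 hk h
  -- The constant is the value at infinity, `q` being monic of degree `k`; the coefficients are the
  -- negated residues.
  refine ⟨R, p.coeff k, fun x => -(Lagrange.nodalWeight R id x * p.eval x),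
    Finset.card_pos.1 (by omega), hneg, fun x hx => ?_, fun t ht => ?_⟩
  · set u := Lagrange.nodal (R.erase x) (id : ℝ → ℝ) with hu
    have hx0 := hneg x hx
    have hqu : q = (X - C x) * u := by rw [hqR, Lagrange.nodal_eq_mul_nodal_erase hx]; rfl
    have hud : u.natDegree = k - 1 := by
      rw [hu, Lagrange.natDegree_nodal, Finset.card_erase_of_mem hx, hR]
    have hu0 : u ≠ 0 := Lagrange.nodal_ne_zero
    -- With `q = (X - x) u`, the values of `u ^ 2 t ^ β` at the nodes are those of `u p / (t - x)`.
    -- The partial fraction formula at `s = -x` then gives the sign of `u(x) p(x)`, which is that of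
    -- the residue `p(x) / u(x)`.
    have h1 := pow_mul_sum_nodalWeight_rpow_pos hβ Z hZ (u * u)
      (by rw [natDegree_mul hu0 hu0]; omega) (mul_ne_zero hu0 hu0)
      (fun x _ => by rw [eval_mul]; exact mul_self_nonneg _)
    have hdeg' : (u * p).natDegree < Z.card := by
      have := natDegree_mul_le (p := u) (q := p); omega
    have h2 := sum_nodalWeight_div_add Z hZ (u * p) hdeg' (s := -x) (by linarith)
    have h3 : ∑ z ∈ Z, Lagrange.nodalWeight Z id z * ((u * u).eval z * z ^ β) =
        ∑ z ∈ Z, Lagrange.nodalWeight Z id z * ((u * p).eval z / (-x + z)) := by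
      refine Finset.sum_congr rfl fun z hz => ?_
      have hzx : -x + z ≠ 0 := by have := hZ z hz; linarith
      rw [eval_mul, eval_mul, ← h z hz, hqu, eval_mul]
      simp only [eval_sub, eval_X, eval_C]
      field_simp
      ring
    rw [h3, h2, neg_neg, eval_mul] at h1
    have hD : 0 < ∏ z ∈ Z, (-x + z) :=
      Finset.prod_pos fun z hz => by have := hZ z hz; linarith
    have h4 : u.eval x * p.eval x < 0 := by
      have := mul_pos h1 hD
      rw [neg_mul, div_mul_cancel₀ _ hD.ne'] at this
      linarith
    have h5 : Lagrange.nodalWeight R id x = (u.eval x)⁻¹ := by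
      rw [Lagrange.nodalWeight_eq_eval_nodal_erase_inv]; rfl
    simp only [h5]
    have hux : u.eval x ≠ 0 := by rintro h0; simp [h0] at h4
    have h6 : (u.eval x)⁻¹ * p.eval x = (u.eval x * p.eval x) * ((u.eval x)⁻¹) ^ 2 := by
      field_simp
    rw [h6]
    have h7 : 0 < ((u.eval x)⁻¹) ^ 2 := by positivity
    have := mul_neg_of_neg_of_pos h4 h7
    linarith
  · have hqk : q.natDegree = k := by rw [hqR, Lagrange.natDegree_nodal, hR]
    have hcoef : q.coeff k = 1 := by rw [← hqk]; exact hq1.coeff_natDegree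
    have hd : (p - C (p.coeff k) * q).natDegree < R.card := by
      rw [hR]
      have h1 : (p - C (p.coeff k) * q).natDegree ≤ k :=
        (natDegree_sub_le _ _).trans (max_le hp ((natDegree_C_mul_le _ _).trans hq))
      refine lt_of_le_of_ne h1 fun he => ?_
      have h2 : (p - C (p.coeff k) * q).coeff k = 0 := by simp [hcoef]
      have h3 : (p - C (p.coeff k) * q) = 0 := by
        rw [← leadingCoeff_eq_zero, leadingCoeff, he, h2]
      rw [h3, natDegree_zero] at he
      omega
    have hne : ∀ x ∈ R, t ≠ x := fun x hx => by have := hneg x hx; linarith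
    have h1 := eval_eq_prod_mul_sum R _ hd t hne
    have hqt : q.eval t = ∏ x ∈ R, (t - x) := by rw [hqR, Lagrange.eval_nodal]; rfl
    have hqt0 : q.eval t ≠ 0 := by
      rw [hqt]; exact Finset.prod_ne_zero_iff.2 fun x hx => sub_ne_zero.2 (hne x hx)
    have h2 : ∑ x ∈ R, Lagrange.nodalWeight R id x * (t - x)⁻¹ *
        (p - C (p.coeff k) * q).eval x =
        - ∑ x ∈ R, -(Lagrange.nodalWeight R id x * p.eval x) / (t - x) := by
      rw [← Finset.sum_neg_distrib]
      refine Finset.sum_congr rfl fun x hx => ?_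
      have : q.eval x = 0 := by rw [hqR]; exact Lagrange.eval_nodal_at_node (v := id) hx
      simp only [eval_sub, eval_mul, eval_C, this]
      ring
    rw [h2, ← hqt] at h1
    simp only [eval_sub, eval_mul, eval_C] at h1
    rw [div_eq_iff hqt0]
    linear_combination h1

/-- A constant minus a positive combination of simple fractions with negative poles increases
strictly and is concave on `[0, 1]`. -/
lemma strictMonoOn_concaveOn_partial_fractions (R : Finset ℝ) (c : ℝ) (a : ℝ → ℝ)
    (hR : R.Nonempty) (hneg : ∀ x ∈ R, x < 0) (ha : ∀ x ∈ R, 0 < a x) :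
    StrictMonoOn (fun t => c - ∑ x ∈ R, a x / (t - x)) (Icc 0 1) ∧
      ConcaveOn ℝ (Icc 0 1) (fun t => c - ∑ x ∈ R, a x / (t - x)) := by
  constructor
  · intro s hs t ht hst
    have : ∑ x ∈ R, a x / (t - x) < ∑ x ∈ R, a x / (s - x) := by
      refine Finset.sum_lt_sum_of_nonempty hR fun x hx => ?_
      have := hneg x hx
      have := hs.1
      exact div_lt_div_of_pos_left (ha x hx) (by linarith) (by linarith)
    simp only
    linarith
  · refine ⟨convex_Icc 0 1, fun s hs t ht u v hu hv huv => ?_⟩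
    simp only [smul_eq_mul]
    have : ∑ x ∈ R, a x / (u * s + v * t - x) ≤
        u * ∑ x ∈ R, a x / (s - x) + v * ∑ x ∈ R, a x / (t - x) := by
      rw [Finset.mul_sum, Finset.mul_sum, ← Finset.sum_add_distrib]
      refine Finset.sum_le_sum fun x hx => ?_
      have hx0 := hneg x hx
      have h1 : s - x ∈ Ioi (0 : ℝ) := by have := hs.1; simp; linarith
      have h2 : t - x ∈ Ioi (0 : ℝ) := by have := ht.1; simp; linarith
      have hc := (convexOn_zpow (-1)).2 h1 h2 hu hv huv
      simp only [smul_eq_mul, zpow_neg_one] at hc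
      have h3 : u * s + v * t - x = u * (s - x) + v * (t - x) := by
        linear_combination x * huv
      rw [h3]
      have := mul_le_mul_of_nonneg_left hc (ha x hx).le
      simp only [div_eq_mul_inv]
      linarith
    have hcc : u * c + v * c = c := by rw [← add_mul, huv, one_mul]
    nlinarith

/-- Such a function grows at most linearly at `0`. -/
lemma exists_partial_fractions_sub_le (R : Finset ℝ) (c : ℝ) (a : ℝ → ℝ)
    (hneg : ∀ x ∈ R, x < 0) (ha : ∀ x ∈ R, 0 < a x) :
    ∃ L : ℝ, ∀ t, 0 ≤ t → (c - ∑ x ∈ R, a x / (t - x)) - (c - ∑ x ∈ R, a x / (0 - x)) ≤ L * t := by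
  -- This slope is the derivative at `0`.
  refine ⟨∑ x ∈ R, a x / (x * x), fun t ht => ?_⟩
  have : ∑ x ∈ R, a x / (0 - x) ≤ ∑ x ∈ R, (a x / (t - x) + a x / (x * x) * t) := by
    refine Finset.sum_le_sum fun x hx => ?_
    have hx0 := hneg x hx
    have hax := ha x hx
    have h1 : 0 < t - x := by linarith
    have h2 : a x / (t - x) + a x / (x * x) * t - a x / (0 - x) =
        a x * t ^ 2 / ((t - x) * (x * x)) := by
      have := h1.ne'
      have := hx0.ne
      have : (0 : ℝ) - x ≠ 0 := by linarith
      field_simp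
      ring
    have h3 : 0 < x * x := mul_pos_of_neg_of_neg hx0 hx0
    have h4 : 0 ≤ a x * t ^ 2 / ((t - x) * (x * x)) := by positivity
    linarith
  rw [Finset.sum_add_distrib, ← Finset.sum_mul] at this
  linarith

/-! ### Alternating chains, separating polynomials and sign changes. -/

/-- An increasing chain of length `n` that lies alternately in `A` and in `B`. -/
def IsAltChain (A B : Set ℝ) (n : ℕ) (x : ℕ → ℝ) : Prop :=
  (∀ i, i + 1 < n → x i < x (i + 1)) ∧ ∀ i < n, (Even i → x i ∈ A) ∧ (¬ Even i → x i ∈ B)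

lemma IsAltChain.cons {A B : Set ℝ} {n : ℕ} {x : ℕ → ℝ} (h : IsAltChain B A n x) {a : ℝ}
    (ha : a ∈ A) (hlt : a < x 0) :
    IsAltChain A B (n + 1) (fun i => Nat.casesOn i a x) := by
  refine ⟨fun i hi => ?_, fun i hi => ?_⟩
  · cases i with
    | zero => exact hlt
    | succ j => exact h.1 j (by omega)
  · cases i with
    | zero => simpa using ha
    | succ j =>
      have := h.2 j (by omega)
      simp only [Nat.even_add_one, not_not]
      exact ⟨this.2, this.1⟩

lemma IsAltChain.mono {A A' B B' : Set ℝ} {n : ℕ} {x : ℕ → ℝ} (h : IsAltChain A B n x)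
    (hA : A ⊆ A') (hB : B ⊆ B') : IsAltChain A' B' n x :=
  ⟨h.1, fun i hi => ⟨fun he => hA ((h.2 i hi).1 he), fun he => hB ((h.2 i hi).2 he)⟩⟩

/-- Disjoint compact sets without a long alternating chain are separated by the sign of a
polynomial of low degree. -/
lemma exists_separating_polynomial_of_least (m : ℕ) : ∀ (A B : Set ℝ), IsCompact A → IsCompact B →
    Disjoint A B → ∀ a ∈ A, (∀ t ∈ B, a ≤ t) → (∀ x, ¬ IsAltChain A B (m + 2) x) →
    ∃ w : ℝ[X], w.natDegree ≤ m ∧ (∀ t ∈ A, 0 < w.eval t) ∧ (∀ t ∈ B, w.eval t < 0) ∧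
      ∀ t ≤ a, 0 < w.eval t := by
  induction m with
  | zero =>
    intro A B hA hB hAB a ha hle hno
    refine ⟨1, by simp, by simp, fun t ht => ?_, by simp⟩
    exfalso
    have hat : a < t := lt_of_le_of_ne (hle t ht)
      (fun h => Set.disjoint_left.1 hAB ha (h ▸ ht))
    exact hno _ (IsAltChain.cons (n := 1) (x := fun _ => t) ⟨fun i hi => by omega, fun i hi => by
      have : i = 0 := by omega
      subst this
      simpa using ht⟩ ha hat)
  | succ m ih =>
    intro A B hA hB hAB a ha hle hno
    rcases B.eq_empty_or_nonempty with rfl | hBn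
    · exact ⟨1, by simp, by simp, by simp, by simp⟩
    obtain ⟨b, hb⟩ := hB.exists_isLeast hBn
    have hab : a < b := lt_of_le_of_ne (hle b hb.1)
      (fun h => Set.disjoint_left.1 hAB ha (h ▸ hb.1))
    -- The roles are exchanged beyond the least point `b` of `B`: a long chain starting in `B` would
    -- extend by `a`.
    obtain ⟨w, hwd, hwB, hwA, hwb⟩ := ih B (A ∩ Ici b) hB (hA.inter_right isClosed_Ici)
      (hAB.symm.mono_right inter_subset_left) b hb.1 (fun t ht => ht.2)
      (fun x hx => hno _ (IsAltChain.cons (hx.mono subset_rfl inter_subset_left) ha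
        (hab.trans_le (hb.2 ((hx.2 0 (by omega)).1 (by simp))))))
    -- One new sign change is placed between `b` and the last point `c` of `A` before it. Positivity
    -- of `w` on all of `t ≤ b` controls the signs to the left.
    obtain ⟨c, hc⟩ := (hA.inter_right (isClosed_Iic (a := b))).exists_isGreatest ⟨a, ha, hab.le⟩
    have hcb : c < b := lt_of_le_of_ne hc.1.2
      (fun h => Set.disjoint_left.1 hAB hc.1.1 (h ▸ hb.1))
    have hac : a ≤ c := hc.2 ⟨ha, hab.le⟩
    obtain ⟨y, hcy, hyb⟩ := exists_between hcb
    refine ⟨(C y - X) * w, ?_, fun t ht => ?_, fun t ht => ?_, fun t ht => ?_⟩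
    · refine natDegree_mul_le.trans ?_
      have : (C y - X : ℝ[X]).natDegree ≤ 1 :=
        (natDegree_sub_le _ _).trans (by simp)
      omega
    · simp only [eval_mul, eval_sub, eval_C, eval_X]
      rcases le_total t b with h | h
      · have : t ≤ c := hc.2 ⟨ht, h⟩
        exact mul_pos (by linarith) (hwb t h)
      · exact mul_pos_of_neg_of_neg (by linarith) (hwA t ⟨ht, h⟩)
    · simp only [eval_mul, eval_sub, eval_C, eval_X]
      exact mul_neg_of_neg_of_pos (by have := hb.2 ht; linarith) (hwB t ht)
    · simp only [eval_mul, eval_sub, eval_C, eval_X]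
      exact mul_pos (by linarith) (hwb t (by linarith))

lemma exists_altChain_or_separating_polynomial (m : ℕ) {A B : Set ℝ} (hA : IsCompact A)
    (hB : IsCompact B) (hAB : Disjoint A B) :
    (∃ x, IsAltChain A B (m + 2) x) ∨ (∃ x, IsAltChain B A (m + 2) x) ∨
    ∃ w : ℝ[X], w.natDegree ≤ m ∧ (∀ t ∈ A, 0 < w.eval t) ∧ (∀ t ∈ B, w.eval t < 0) := by
  by_contra hcon
  push Not at hcon
  obtain ⟨h1, h2, h3⟩ := hcon
  rcases (A ∪ B).eq_empty_or_nonempty with he | hne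
  · obtain ⟨rfl, rfl⟩ := Set.union_empty_iff.1 he
    obtain ⟨t, ht, -⟩ := h3 1 (by simp) (by simp)
    exact ht
  obtain ⟨a, ha⟩ := (hA.union hB).exists_isLeast hne
  rcases ha.1 with haA | haB
  · obtain ⟨w, hw1, hw2, hw3, -⟩ := exists_separating_polynomial_of_least m A B hA hB hAB a haA
      (fun t ht => ha.2 (Or.inr ht)) h1
    obtain ⟨t, ht, h⟩ := h3 w hw1 hw2
    exact absurd (hw3 t ht) (not_lt.2 h)
  · obtain ⟨w, hw1, hw2, hw3, -⟩ := exists_separating_polynomial_of_least m B A hB hA hAB.symm a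
      haB (fun t ht => ha.2 (Or.inl ht)) h2
    obtain ⟨t, ht, h⟩ := h3 (-w) (by simpa using hw1) (fun t ht => by simpa using hw3 t ht)
    have := hw2 t ht
    simp at h
    linarith

/-- A continuous function with `N` sign changes has `N` zeros. -/
lemma exists_zeros_of_alternating {g : ℝ → ℝ} (hg : ContinuousOn g (Icc 0 1)) {N : ℕ}
    {x : ℕ → ℝ} (hx : ∀ i < N + 1, x i ∈ Icc (0 : ℝ) 1) (hlt : ∀ i < N, x i < x (i + 1))
    (hs : ∀ i < N + 1, 0 < (-1) ^ i * g (x i)) :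
    ∃ Z : Finset ℝ, Z.card = N ∧ ∀ z ∈ Z, 0 < z ∧ z ≤ 1 ∧ g z = 0 := by
  have hz : ∀ i, ∃ z, i < N → x i < z ∧ z < x (i + 1) ∧ g z = 0 := by
    intro i
    by_cases hi : i < N
    · have hsub : Icc (x i) (x (i + 1)) ⊆ Icc 0 1 :=
        Icc_subset_Icc (hx i (by omega)).1 (hx (i + 1) (by omega)).2
      have hg' : ContinuousOn (fun t => (-1) ^ i * g t) (Icc (x i) (x (i + 1))) :=
        continuousOn_const.mul (hg.mono hsub)
      have h1 := hs i (by omega)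
      have h2 := hs (i + 1) (by omega)
      rw [pow_succ] at h2
      -- Zeros strictly between the given points are distinct and positive, as nodes must be.
      obtain ⟨z, hz, hz0⟩ := intermediate_value_Ioo' (hlt i hi).le hg'
        (show (0 : ℝ) ∈ Ioo _ _ from ⟨by linarith, h1⟩)
      refine ⟨z, fun _ => ⟨hz.1, hz.2, ?_⟩⟩
      simpa using hz0
    · exact ⟨0, fun h => absurd h hi⟩
  choose z hz using hz
  have hxm : ∀ j, j < N + 1 → ∀ i ≤ j, x i ≤ x j := by
    intro j
    induction j with
    | zero => intro _ i hi; rw [Nat.le_zero.1 hi]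
    | succ j ih =>
      intro hj i hi
      rcases Nat.lt_or_ge i (j + 1) with h | h
      · exact (ih (by omega) i (by omega)).trans (hlt j (by omega)).le
      · rw [le_antisymm hi h]
  have hzlt : ∀ i j, i < j → j < N → z i < z j := fun i j hij hj =>
    ((hz i (by omega)).2.1.trans_le (hxm j (by omega) (i + 1) hij)).trans (hz j hj).1
  refine ⟨(Finset.range N).image z, ?_, fun y hy => ?_⟩
  · rw [Finset.card_image_of_injOn, Finset.card_range]
    intro i hi j hj hij
    simp only [Finset.coe_range, mem_Iio] at hi hj
    rcases lt_trichotomy i j with h | h | h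
    · exact absurd hij (hzlt i j h hj).ne
    · exact h
    · exact absurd hij (hzlt j i h hi).ne'
  · obtain ⟨i, hi, rfl⟩ := Finset.mem_image.1 hy
    have hi := Finset.mem_range.1 hi
    have h := hz i hi
    exact ⟨(hx i (by omega)).1.trans_lt h.1, h.2.1.le.trans (hx (i + 1) (by omega)).2, h.2.2⟩

/-! ### Bézout identity with degree bounds. -/

/-- Reducing the cofactor of `p` modulo `q` bounds its degree; the bound on the other cofactor
follows from `a q = w - b p`. -/
lemma exists_bezout_degree_le_aux {p q w : ℝ[X]} (hpq : IsCoprime p q) (hq : q ≠ 0) {k : ℕ}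
    (hp : p.natDegree ≤ q.natDegree) (hk : q.natDegree ≤ k)
    (hw : w.natDegree ≤ k + q.natDegree) :
    ∃ a b : ℝ[X], a.natDegree ≤ k ∧ b.natDegree ≤ k ∧ a * q + b * p = w := by
  obtain ⟨v, u, huv⟩ := hpq
  set b := (w * v) % q with hb
  have hdb : b.natDegree ≤ q.natDegree :=
    natDegree_le_natDegree (EuclideanDomain.mod_lt (w * v) hq).le
  have heq : (w * u + (w * v) / q * p) * q + b * p = w := by
    have h := EuclideanDomain.div_add_mod (w * v) q
    linear_combination w * huv + p * h
  refine ⟨_, b, ?_, hdb.trans hk, heq⟩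
  set a := w * u + (w * v) / q * p
  by_cases ha : a = 0
  · simp [ha]
  have h1 : (a * q).natDegree ≤ k + q.natDegree := by
    rw [show a * q = w - b * p by linear_combination heq]
    refine (natDegree_sub_le _ _).trans (max_le hw ?_)
    refine natDegree_mul_le.trans ?_
    omega
  rw [natDegree_mul ha hq] at h1
  omega

/-- Bézout's identity with degree bounds. -/
lemma exists_bezout_degree_le {p q w : ℝ[X]} (hpq : IsCoprime p q) (hq : q ≠ 0) {k : ℕ}
    (hp : p.natDegree ≤ k) (hk : q.natDegree ≤ k)
    (hw : w.natDegree ≤ k + max p.natDegree q.natDegree) :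
    ∃ a b : ℝ[X], a.natDegree ≤ k ∧ b.natDegree ≤ k ∧ a * q - b * p = w := by
  rcases le_or_gt p.natDegree q.natDegree with h | h
  · rw [max_eq_right h] at hw
    obtain ⟨a, b, ha, hb, hab⟩ := exists_bezout_degree_le_aux hpq hq h hk hw
    exact ⟨a, -b, ha, by simpa using hb, by linear_combination hab⟩
  · rw [max_eq_left h.le] at hw
    have hp0 : p ≠ 0 := by rintro rfl; simp at h
    obtain ⟨b, a, hb, ha, hab⟩ := exists_bezout_degree_le_aux hpq.symm hp0 h.le hp hw
    exact ⟨a, -b, ha, by simpa using hb, by linear_combination hab⟩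

/-! ### Evaluation and uniform error of rational functions. -/

lemma ratEval_div (P : ℝ[X]) {Q : ℝ[X]} {t : ℝ} (hQ : Q.eval t ≠ 0) :
    ratEval (algebraMap ℝ[X] (RatFunc ℝ) P / algebraMap ℝ[X] (RatFunc ℝ) Q) t =
      P.eval t / Q.eval t := by
  have hQ0 : Q ≠ 0 := by rintro rfl; simp at hQ
  set r := algebraMap ℝ[X] (RatFunc ℝ) P / algebraMap ℝ[X] (RatFunc ℝ) Q with hr
  have h1 : r.num * Q = P * r.denom := (RatFunc.num_mul_eq_mul_denom_iff hQ0).2 hr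
  have h2 : r.denom.eval t ≠ 0 := by
    obtain ⟨u, hu⟩ := RatFunc.denom_div_dvd P Q
    intro h
    rw [hu, eval_mul, h, zero_mul] at hQ
    exact hQ rfl
  change r.num.eval t / r.denom.eval t = _
  rw [div_eq_div_iff h2 hQ, ← eval_mul, h1, eval_mul]

lemma div_mem_ratClass {k m : ℕ} {P Q : ℝ[X]} (hP : P.natDegree ≤ k) (hQ : Q.natDegree ≤ m)
    (hQ0 : Q ≠ 0) :
    algebraMap ℝ[X] (RatFunc ℝ) P / algebraMap ℝ[X] (RatFunc ℝ) Q ∈ ratClass k m := by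
  have hl : Q.leadingCoeff ≠ 0 := leadingCoeff_ne_zero.2 hQ0
  refine ⟨C Q.leadingCoeff⁻¹ * P, C Q.leadingCoeff⁻¹ * Q, (natDegree_C_mul_le _ _).trans hP,
    (natDegree_C_mul_le _ _).trans hQ, ?_, ?_⟩
  · rw [mul_comm]; exact monic_mul_leadingCoeff_inv hQ0
  · rw [map_mul, map_mul, mul_div_mul_left]
    exact RatFunc.algebraMap_ne_zero (C_ne_zero.2 (inv_ne_zero hl))

lemma natDegree_num_le {k m : ℕ} {r : RatFunc ℝ} (hr : r ∈ ratClass k m) :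
    r.num.natDegree ≤ k := by
  obtain ⟨P, Q, hP, hQ, hQ1, rfl⟩ := hr
  by_cases hP0 : P = 0
  · simp [hP0]
  · exact (natDegree_le_of_dvd (RatFunc.num_div_dvd P hQ1.ne_zero) hP0).trans hP

lemma natDegree_denom_le {k m : ℕ} {r : RatFunc ℝ} (hr : r ∈ ratClass k m) :
    r.denom.natDegree ≤ m := by
  obtain ⟨P, Q, hP, hQ, hQ1, rfl⟩ := hr
  exact (natDegree_le_of_dvd (RatFunc.denom_div_dvd P Q) hQ1.ne_zero).trans hQ

lemma uniformError_le {α E : ℝ} {r : RatFunc ℝ}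
    (h : ∀ t ∈ Ioo (0 : ℝ) 1, |t ^ (1 - α) - ratEval r t| ≤ E) :
    uniformError α r ≤ ENNReal.ofReal E := by
  rw [uniformError, eLpNorm_exponent_top]
  exact eLpNormEssSup_le_of_ae_bound
    ((ae_restrict_iff' measurableSet_Ioo).2 (Eventually.of_forall h))

/-- An inequality between continuous functions that holds almost everywhere on `(0, 1)` holds
on `[0, 1]`. -/
lemma le_on_Icc_of_ae_le {g h : ℝ → ℝ} (hg : Continuous g) (hh : Continuous h)
    (hle : ∀ᵐ t ∂volume.restrict (Ioo (0 : ℝ) 1), g t ≤ h t) : ∀ t ∈ Icc (0 : ℝ) 1, g t ≤ h t := by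
  intro t ht
  by_contra! hlt
  have hU : IsOpen {s | h s < g s} := isOpen_lt hh hg
  rw [← closure_Ioo (zero_ne_one' ℝ)] at ht
  have hne : ({s | h s < g s} ∩ Ioo 0 1).Nonempty := mem_closure_iff.1 ht _ hU hlt
  have hpos := (hU.inter isOpen_Ioo).measure_pos volume hne
  rw [ae_iff, Measure.restrict_apply' measurableSet_Ioo] at hle
  simp only [not_le] at hle
  exact hpos.ne' hle

/-- Multiplication by the denominator makes both sides continuous even before poles are excluded, so
the almost everywhere bound holds at every point, endpoints included. -/
lemma abs_mul_denom_sub_num_le {α : ℝ} (hα1 : α < 1) {r : RatFunc ℝ}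
    (hr : uniformError α r ≠ ⊤) : ∀ t ∈ Icc (0 : ℝ) 1,
    |r.denom.eval t * t ^ (1 - α) - r.num.eval t| ≤
      (uniformError α r).toReal * |r.denom.eval t| := by
  have hf : Continuous fun t : ℝ => t ^ (1 - α) := Real.continuous_rpow_const (by linarith)
  refine le_on_Icc_of_ae_le (by fun_prop) (by fun_prop) ?_
  have h1 : ∀ᵐ t ∂volume.restrict (Ioo (0 : ℝ) 1), t ∉ r.denom.rootSet ℝ :=
    ae_restrict_of_ae ((r.denom.rootSet_finite ℝ).measure_zero _ |> measure_eq_zero_iff_ae_notMem.1)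
  have h2 := ae_le_eLpNormEssSup (μ := volume.restrict (Ioo (0 : ℝ) 1))
    (f := fun t : ℝ => t ^ (1 - α) - ratEval r t)
  rw [← eLpNorm_exponent_top] at h2
  filter_upwards [h1, h2] with t ht1 ht2
  have hq : r.denom.eval t ≠ 0 := fun h => ht1 (by
    rw [mem_rootSet]; exact ⟨r.denom_ne_zero, by simpa [aeval_def] using h⟩)
  have h3 : |t ^ (1 - α) - ratEval r t| ≤ (uniformError α r).toReal := by
    have := ENNReal.toReal_mono hr ht2
    simpa using this
  have h4 : r.denom.eval t * t ^ (1 - α) - r.num.eval t =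
      (t ^ (1 - α) - ratEval r t) * r.denom.eval t := by
    have : ratEval r t = r.num.eval t / r.denom.eval t := rfl
    rw [this]
    field_simp
  rw [h4, abs_mul]
  gcongr

/-- At a zero of the denominator the previous bound makes the numerator vanish too, against
coprimality. -/
lemma denom_eval_ne_zero {α : ℝ} (hα1 : α < 1) {r : RatFunc ℝ} (hr : uniformError α r ≠ ⊤)
    {t : ℝ} (ht : t ∈ Icc (0 : ℝ) 1) : r.denom.eval t ≠ 0 := by
  intro h
  have h1 := abs_mul_denom_sub_num_le hα1 hr t ht
  rw [h] at h1
  simp only [zero_mul, zero_sub, abs_neg, abs_zero, mul_zero, abs_nonpos_iff] at h1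
  obtain ⟨u, v, huv⟩ := r.isCoprime_num_denom
  have h2 := congrArg (eval t) huv
  simp [h, h1] at h2

lemma uniformError_ne_top {α : ℝ} (hα1 : α < 1) {k m : ℕ} {r : RatFunc ℝ}
    (hr : IsBURA α k m r) : uniformError α r ≠ ⊤ := by
  have h0 : (0 : RatFunc ℝ) ∈ ratClass k m := ⟨0, 1, by simp, by simp, monic_one, by simp⟩
  refine ne_top_of_le_ne_top ENNReal.ofReal_ne_top ((hr.2 0 h0).trans
    (uniformError_le (E := 1) fun t ht => ?_))
  have : ratEval 0 t = 0 := by simp [ratEval]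
  rw [this, sub_zero, abs_of_nonneg (Real.rpow_nonneg ht.1.le _)]
  exact Real.rpow_le_one ht.1.le ht.2.le (by linarith)

lemma minimaxError_eq {α : ℝ} {k m : ℕ} {r : RatFunc ℝ} (hr : IsBURA α k m r) :
    minimaxError α k m = (uniformError α r).toReal := by
  rw [minimaxError]
  congr 1
  exact le_antisymm (iInf₂_le r hr.1) (le_iInf₂ hr.2)

/-! ### The alternation theorem. -/

/-- If the cross polynomial `a q - b p` has the sign of the error at all its extremal points,
then perturbing the quotient `p / q` in the direction `(a, b)` lowers the error. -/
lemma exists_better_quotient {f : ℝ → ℝ} (hf : Continuous f) {p q a b : ℝ[X]} {E : ℝ}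
    (hE : 0 < E) (hq : ∀ t ∈ Icc (0 : ℝ) 1, q.eval t ≠ 0)
    (hle : ∀ t ∈ Icc (0 : ℝ) 1, |f t - p.eval t / q.eval t| ≤ E)
    (hpos : ∀ t ∈ Icc (0 : ℝ) 1, f t - p.eval t / q.eval t = E → 0 < (a * q - b * p).eval t)
    (hneg : ∀ t ∈ Icc (0 : ℝ) 1, f t - p.eval t / q.eval t = -E → (a * q - b * p).eval t < 0) :
    ∃ ε E' : ℝ, E' < E ∧ ∀ t ∈ Icc (0 : ℝ) 1, (q + C ε * b).eval t ≠ 0 ∧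
      |f t - (p + C ε * a).eval t / (q + C ε * b).eval t| ≤ E' := by
  have hev : ∀ᶠ ε in 𝓝 (0 : ℝ), ∀ t ∈ Icc (0 : ℝ) 1, 0 < ε → t ∈ Icc (0 : ℝ) 1 →
      (q + C ε * b).eval t ≠ 0 ∧ |f t - (p + C ε * a).eval t / (q + C ε * b).eval t| < E := by
    -- By compactness a local claim near each `(0, t)` suffices; it is clear where the error is
    -- below `E` in modulus.
    refine isCompact_Icc.eventually_forall_of_forall_eventually fun t ht => ?_
    have hqt := hq t ht
    have hc1 : Continuous fun z : ℝ × ℝ => (q + C z.1 * b).eval z.2 := by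
      simp only [eval_add, eval_mul, eval_C]; fun_prop
    have hc2 : Continuous fun z : ℝ × ℝ => (p + C z.1 * a).eval z.2 := by
      simp only [eval_add, eval_mul, eval_C]; fun_prop
    have hne : ∀ᶠ z : ℝ × ℝ in 𝓝 (0, t), (q + C z.1 * b).eval z.2 ≠ 0 :=
      hc1.continuousAt.eventually_ne (by simpa using hqt)
    rcases (hle t ht).lt_or_eq with hlt | heq
    · have hca : ContinuousAt (fun z : ℝ × ℝ => |f z.2 - (p + C z.1 * a).eval z.2 /
          (q + C z.1 * b).eval z.2|) (0, t) :=
        ((hf.comp continuous_snd).continuousAt.sub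
          (hc2.continuousAt.div hc1.continuousAt (by simpa using hqt))).abs
      have hlt' := hca.eventually_lt (continuousAt_const (y := E)) (by simpa using hlt)
      filter_upwards [hne, hlt'] with z h1 h2 _ _ using ⟨h1, h2⟩
    · set w := a * q - b * p with hw
      have hwt : 0 < (f t - p.eval t / q.eval t) * w.eval t := by
        rcases eq_or_eq_neg_of_abs_eq heq with h | h
        · rw [h]; exact mul_pos hE (hpos t ht h)
        · rw [h]; exact mul_pos_of_neg_of_neg (by linarith) (hneg t ht h)
      have hqz : ∀ᶠ z : ℝ × ℝ in 𝓝 (0, t), q.eval z.2 ≠ 0 :=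
        (by fun_prop : ContinuousAt (fun z : ℝ × ℝ => q.eval z.2) (0, t)).eventually_ne hqt
      -- The perturbed error is `e - ε d` with `d = w / (q (q + ε b))`. This function is `(e ^ 2 -
      -- (e - ε d) ^ 2) / ε`, which is positive at `(0, t)` because `e` and `w` have the same sign
      -- there.
      have hG : ContinuousAt (fun z : ℝ × ℝ => 2 * (f z.2 - p.eval z.2 / q.eval z.2) *
          (w.eval z.2 / (q.eval z.2 * (q + C z.1 * b).eval z.2)) -
          z.1 * (w.eval z.2 / (q.eval z.2 * (q + C z.1 * b).eval z.2)) ^ 2) (0, t) := by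
        have hd : ContinuousAt (fun z : ℝ × ℝ =>
            w.eval z.2 / (q.eval z.2 * (q + C z.1 * b).eval z.2)) (0, t) :=
          (by fun_prop : ContinuousAt (fun z : ℝ × ℝ => w.eval z.2) (0, t)).div
            ((by fun_prop : ContinuousAt (fun z : ℝ × ℝ => q.eval z.2) (0, t)).mul
              hc1.continuousAt) (by simpa using hqt)
        have he : ContinuousAt (fun z : ℝ × ℝ => f z.2 - p.eval z.2 / q.eval z.2) (0, t) :=
          (hf.comp continuous_snd).continuousAt.sub
            ((by fun_prop : ContinuousAt (fun z : ℝ × ℝ => p.eval z.2) (0, t)).div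
              (by fun_prop : ContinuousAt (fun z : ℝ × ℝ => q.eval z.2) (0, t)) hqt)
        exact ((continuousAt_const.mul he).mul hd).sub (continuousAt_fst.mul (hd.pow 2))
      have hGpos := (continuousAt_const (y := (0 : ℝ))).eventually_lt hG (by
        simp only [map_zero, zero_mul, add_zero, sub_zero]
        have : 0 < q.eval t * q.eval t := mul_self_pos.2 hqt
        have h1 : 2 * (f t - p.eval t / q.eval t) * (w.eval t / (q.eval t * q.eval t)) =
          2 * ((f t - p.eval t / q.eval t) * w.eval t) / (q.eval t * q.eval t) := by ring
        rw [h1]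
        positivity)
      filter_upwards [hne, hqz, hGpos] with z h1 h2 h3 hz hzI
      refine ⟨h1, ?_⟩
      set e := f z.2 - p.eval z.2 / q.eval z.2 with he
      set d := w.eval z.2 / (q.eval z.2 * (q + C z.1 * b).eval z.2) with hd
      have h4 : f z.2 - (p + C z.1 * a).eval z.2 / (q + C z.1 * b).eval z.2 = e - z.1 * d := by
        rw [he, hd, hw]
        simp only [eval_add, eval_sub, eval_mul, eval_C] at h1 ⊢
        field_simp
        ring
      rw [h4]
      have h5 : e ^ 2 ≤ E ^ 2 := sq_le_sq' (abs_le.1 (hle _ hzI)).1 (abs_le.1 (hle _ hzI)).2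
      have h6 := mul_pos hz h3
      exact abs_lt_of_sq_lt_sq (by nlinarith) hE.le
  obtain ⟨ε, hε, hε0⟩ := ((hev.filter_mono nhdsWithin_le_nhds).and
    (self_mem_nhdsWithin (s := Ioi (0 : ℝ)))).exists
  have hε0 : 0 < ε := hε0
  have hall : ∀ t ∈ Icc (0 : ℝ) 1, (q + C ε * b).eval t ≠ 0 ∧
      |f t - (p + C ε * a).eval t / (q + C ε * b).eval t| < E := fun t ht => hε t ht hε0 ht
  have hcont : ContinuousOn
      (fun t => |f t - (p + C ε * a).eval t / (q + C ε * b).eval t|) (Icc 0 1) :=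
    (hf.continuousOn.sub ((p + C ε * a).continuousOn.div (q + C ε * b).continuousOn
      fun t ht => (hall t ht).1)).abs
  obtain ⟨y, hy, hmax⟩ := isCompact_Icc.exists_isMaxOn (nonempty_Icc.2 zero_le_one) hcont
  exact ⟨ε, _, (hall y hy).2, fun t ht => ⟨(hall t ht).1, hmax ht⟩⟩

/-- With zero error, `r` would interpolate `t ^ β` at arbitrarily many points. -/
lemma uniformError_pos {α : ℝ} (hα0 : 0 < α) (hα1 : α < 1) {r : RatFunc ℝ}
    (hr : uniformError α r ≠ ⊤) : 0 < (uniformError α r).toReal := by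
  refine lt_of_le_of_ne ENNReal.toReal_nonneg fun h => ?_
  have h1 := abs_mul_denom_sub_num_le hα1 hr
  rw [← h] at h1
  set n := max r.num.natDegree r.denom.natDegree
  obtain ⟨Z, hZ, hcard⟩ := (Ioo_infinite (zero_lt_one' ℝ)).exists_subset_card_eq (2 * n + 2)
  refine r.denom_ne_zero (eq_zero_of_rpow_interpolation (β := 1 - α)
    ⟨by linarith, by linarith⟩ Z (fun z hz => (hZ hz).1) (le_max_left _ _) (le_max_right _ _)
    hcard.ge fun z hz => ?_)
  have h2 := h1 z (Ioo_subset_Icc_self (hZ hz))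
  rw [zero_mul, abs_nonpos_iff] at h2
  exact sub_eq_zero.1 h2

lemma abs_error_le {α : ℝ} (hα1 : α < 1) {r : RatFunc ℝ} (hr : uniformError α r ≠ ⊤)
    {t : ℝ} (ht : t ∈ Icc (0 : ℝ) 1) :
    |t ^ (1 - α) - ratEval r t| ≤ (uniformError α r).toReal := by
  have hq := denom_eval_ne_zero hα1 hr ht
  have h := abs_mul_denom_sub_num_le hα1 hr t ht
  have h4 : r.denom.eval t * t ^ (1 - α) - r.num.eval t =
      (t ^ (1 - α) - ratEval r t) * r.denom.eval t := by
    have : ratEval r t = r.num.eval t / r.denom.eval t := rfl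
    rw [this]
    field_simp
  rw [h4, abs_mul] at h
  exact le_of_mul_le_mul_right h (abs_pos.2 hq)

lemma continuousOn_error {α : ℝ} (hα1 : α < 1) {r : RatFunc ℝ} (hr : uniformError α r ≠ ⊤) :
    ContinuousOn (fun t : ℝ => t ^ (1 - α) - ratEval r t) (Icc 0 1) :=
  (Real.continuous_rpow_const (by linarith)).continuousOn.sub
    (r.num.continuousOn.div r.denom.continuousOn fun _ ht => denom_eval_ne_zero hα1 hr ht)

/-- The error of a best approximation alternates. -/
lemma exists_alternation {α : ℝ} (hα0 : 0 < α) (hα1 : α < 1) {k : ℕ} {r : RatFunc ℝ}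
    (hr : IsBURA α k k r) :
    ∃ σ : ℝ, (σ = 1 ∨ σ = -1) ∧ ∃ x : ℕ → ℝ,
      (∀ i < k + max r.num.natDegree r.denom.natDegree + 1, x i < x (i + 1)) ∧
      ∀ i < k + max r.num.natDegree r.denom.natDegree + 2, x i ∈ Icc (0 : ℝ) 1 ∧
        (-1) ^ i * (σ * (x i ^ (1 - α) - ratEval r (x i))) = (uniformError α r).toReal := by
  have hfin := uniformError_ne_top hα1 hr
  have hE := uniformError_pos hα0 hα1 hfin
  have hle := fun t ht => abs_error_le hα1 hfin (t := t) ht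
  have hc := continuousOn_error hα1 hfin
  have hq := fun t ht => denom_eval_ne_zero hα1 hfin (t := t) ht
  have hofReal : ENNReal.ofReal (uniformError α r).toReal = uniformError α r :=
    ENNReal.ofReal_toReal hfin
  set E := (uniformError α r).toReal
  set m := k + max r.num.natDegree r.denom.natDegree with hm
  have hcpt : ∀ y : ℝ, IsCompact {t ∈ Icc (0 : ℝ) 1 | t ^ (1 - α) - ratEval r t = y} := fun y =>
    isCompact_Icc.of_isClosed_subset (hc.preimage_isClosed_of_isClosed isClosed_Icc
      (isClosed_singleton (x := y))) fun t ht => ht.1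
  rcases exists_altChain_or_separating_polynomial m (hcpt E) (hcpt (-E))
    (Set.disjoint_left.2 fun t h1 h2 => by have := h1.2.symm.trans h2.2; linarith) with
    ⟨x, hx1, hx2⟩ | ⟨x, hx1, hx2⟩ | ⟨w, hwd, hwA, hwB⟩
  · refine ⟨1, Or.inl rfl, x, fun i hi => hx1 i (by omega), fun i hi => ?_⟩
    by_cases he : Even i
    · obtain ⟨h1, h2⟩ := (hx2 i hi).1 he
      exact ⟨h1, by rw [he.neg_one_pow, h2]; ring⟩
    · obtain ⟨h1, h2⟩ := (hx2 i hi).2 he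
      exact ⟨h1, by rw [(Nat.not_even_iff_odd.1 he).neg_one_pow, h2]; ring⟩
  · refine ⟨-1, Or.inr rfl, x, fun i hi => hx1 i (by omega), fun i hi => ?_⟩
    by_cases he : Even i
    · obtain ⟨h1, h2⟩ := (hx2 i hi).1 he
      exact ⟨h1, by rw [he.neg_one_pow, h2]; ring⟩
    · obtain ⟨h1, h2⟩ := (hx2 i hi).2 he
      exact ⟨h1, by rw [(Nat.not_even_iff_odd.1 he).neg_one_pow, h2]; ring⟩
  · exfalso
    have hp := natDegree_num_le hr.1
    have hq' := natDegree_denom_le hr.1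
    -- The separating polynomial is realised as a cross polynomial `a q - b p`, so the perturbation
    -- beats `r`.
    obtain ⟨a, b, ha, hb, hab⟩ := exists_bezout_degree_le r.isCoprime_num_denom
      r.denom_ne_zero hp hq' hwd
    obtain ⟨ε, E', hE', hall⟩ := exists_better_quotient
      (f := fun t : ℝ => t ^ (1 - α)) (Real.continuous_rpow_const (by linarith)) (a := a) (b := b)
      hE hq hle (fun t ht h => by rw [hab]; exact hwA t ⟨ht, h⟩)
      (fun t ht h => by rw [hab]; exact hwB t ⟨ht, h⟩)
    have hd : ∀ u v : ℝ[X], u.natDegree ≤ k → v.natDegree ≤ k → (u + C ε * v).natDegree ≤ k :=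
      fun u v hu hv => (natDegree_add_le _ _).trans (max_le hu ((natDegree_C_mul_le _ _).trans hv))
    have h0 : r.denom + C ε * b ≠ 0 := fun h => (hall 0 (by simp)).1 (by rw [h, eval_zero])
    have h1 := hr.2 _ (div_mem_ratClass (hd _ _ hp ha) (hd _ _ hq' hb) h0)
    have h2 := h1.trans (uniformError_le (E := E') fun t ht => by
      have := hall t (Ioo_subset_Icc_self ht)
      rw [ratEval_div _ this.1]
      exact this.2)
    rw [← hofReal] at h2
    exact absurd h2 (not_le.2 ((ENNReal.ofReal_lt_ofReal_iff hE).2 hE'))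

/-! ### Zero counting for the error of a best approximation. -/

/-- The error of a rational function of degree `n`, shifted by a constant, changes sign at most
`2 n + 1` times. -/
lemma not_alternating_error_sub_const {α : ℝ} (hα0 : 0 < α) (hα1 : α < 1) {r : RatFunc ℝ}
    (hr : uniformError α r ≠ ⊤) {n : ℕ} (hp : r.num.natDegree ≤ n) (hq : r.denom.natDegree ≤ n)
    {σ : ℝ} (hσ : σ ≠ 0) (c : ℝ) (x : ℕ → ℝ) (hlt : ∀ i < 2 * n + 2, x i < x (i + 1))
    (hx : ∀ i < 2 * n + 3, x i ∈ Icc (0 : ℝ) 1 ∧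
      0 < (-1) ^ i * (σ * (x i ^ (1 - α) - ratEval r (x i)) - c)) : False := by
  obtain ⟨Z, hcard, hZ⟩ := exists_zeros_of_alternating
    (g := fun t => σ * (t ^ (1 - α) - ratEval r t) - c)
    ((continuousOn_const.mul (continuousOn_error hα1 hr)).sub continuousOn_const)
    (fun i hi => (hx i hi).1) hlt (fun i hi => (hx i hi).2)
  -- A zero of the shifted error satisfies `σ q t ^ β = σ p + c q`: the shift does not raise the
  -- degree.
  have h := eq_zero_of_rpow_interpolation (β := 1 - α) ⟨by linarith, by linarith⟩ Z
    (fun z hz => (hZ z hz).1) (n := n) (q := C σ * r.denom) (p := C σ * r.num + C c * r.denom)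
    ((natDegree_add_le _ _).trans
      (max_le ((natDegree_C_mul_le _ _).trans hp) ((natDegree_C_mul_le _ _).trans hq)))
    ((natDegree_C_mul_le _ _).trans hq) hcard.ge fun z hz => by
      obtain ⟨h0, h1, h2⟩ := hZ z hz
      have hqz := denom_eval_ne_zero hα1 hr ⟨h0.le, h1⟩
      have h3 : ratEval r z = r.num.eval z / r.denom.eval z := rfl
      rw [h3] at h2
      simp only [eval_add, eval_mul, eval_C]
      have h4 : σ * (z ^ (1 - α) - r.num.eval z / r.denom.eval z) * r.denom.eval z =
          c * r.denom.eval z := by rw [sub_eq_zero.1 h2]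
      have h5 : r.num.eval z / r.denom.eval z * r.denom.eval z = r.num.eval z :=
        div_mul_cancel₀ _ hqz
      linear_combination h4 + σ * h5
  exact mul_ne_zero (C_ne_zero.2 hσ) r.denom_ne_zero h

/-- The defect of a best approximation of `t ^ (1 - α)` is zero. -/
lemma max_natDegree_eq {α : ℝ} (hα0 : 0 < α) (hα1 : α < 1) {k : ℕ} {r : RatFunc ℝ}
    (hr : IsBURA α k k r) : max r.num.natDegree r.denom.natDegree = k := by
  have hfin := uniformError_ne_top hα1 hr
  have hE := uniformError_pos hα0 hα1 hfin
  obtain ⟨σ, hσ, x, hlt, hx⟩ := exists_alternation hα0 hα1 hr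
  have hle : max r.num.natDegree r.denom.natDegree ≤ k :=
    max_le (natDegree_num_le hr.1) (natDegree_denom_le hr.1)
  by_contra hne
  -- If the degree `n` were below `k`, the `k + n + 2` alternation points would number at least `2n
  -- + 3`.
  refine not_alternating_error_sub_const hα0 hα1 hfin (le_max_left _ _) (le_max_right _ _)
    (σ := σ) (by rcases hσ with rfl | rfl <;> norm_num) 0 x (fun i hi => hlt i (by omega))
    fun i hi => ?_
  obtain ⟨h1, h2⟩ := hx i (by omega)
  exact ⟨h1, by rw [sub_zero, h2]; exact hE⟩

/-- On `[0, ∞)` a best approximation is a constant minus a positive combination of simple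
fractions with negative poles. -/
lemma exists_ratEval_eq_partial_fractions {α : ℝ} (hα0 : 0 < α) (hα1 : α < 1) {k : ℕ}
    (hk : 1 ≤ k) {r : RatFunc ℝ} (hr : IsBURA α k k r) :
    ∃ (R : Finset ℝ) (c : ℝ) (a : ℝ → ℝ), R.Nonempty ∧ (∀ x ∈ R, x < 0) ∧ (∀ x ∈ R, 0 < a x) ∧
      ∀ t, 0 ≤ t → ratEval r t = c - ∑ x ∈ R, a x / (t - x) := by
  have hfin := uniformError_ne_top hα1 hr
  have hE := uniformError_pos hα0 hα1 hfin
  obtain ⟨σ, hσ, x, hlt, hx⟩ := exists_alternation hα0 hα1 hr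
  rw [max_natDegree_eq hα0 hα1 hr] at hlt hx
  obtain ⟨Z, hcard, hZ⟩ := exists_zeros_of_alternating (N := 2 * k + 1)
    (g := fun t => σ * (t ^ (1 - α) - ratEval r t))
    (continuousOn_const.mul (continuousOn_error hα1 hfin))
    (fun i hi => (hx i (by omega)).1) (fun i hi => hlt i (by omega))
    (fun i hi => by rw [(hx i (by omega)).2]; exact hE)
  refine exists_partial_fractions (β := 1 - α) ⟨by linarith, by linarith⟩ Z
    (fun z hz => (hZ z hz).1) (natDegree_num_le hr.1) (natDegree_denom_le hr.1)
    r.monic_denom hk hcard fun z hz => ?_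
  obtain ⟨h0, h1, h2⟩ := hZ z hz
  have hqz := denom_eval_ne_zero hα1 hfin ⟨h0.le, h1⟩
  have hσ0 : σ ≠ 0 := by rcases hσ with rfl | rfl <;> norm_num
  have h3 : z ^ (1 - α) = r.num.eval z / r.denom.eval z :=
    sub_eq_zero.1 ((mul_eq_zero.1 h2).resolve_left hσ0)
  rw [h3, mul_div_cancel₀ _ hqz]

/-- The origin is an extremal point of the error of a best approximation. -/
lemma error_zero_eq {α : ℝ} (hα0 : 0 < α) (hα1 : α < 1) {k : ℕ} {r : RatFunc ℝ}
    (hr : IsBURA α k k r) :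
    ((0 : ℝ) ^ (1 - α) - ratEval r 0 = (uniformError α r).toReal) ∨
      ((0 : ℝ) ^ (1 - α) - ratEval r 0 = -(uniformError α r).toReal) := by
  have hfin := uniformError_ne_top hα1 hr
  have hE := uniformError_pos hα0 hα1 hfin
  obtain ⟨σ, hσ, x, hlt, hx⟩ := exists_alternation hα0 hα1 hr
  rw [max_natDegree_eq hα0 hα1 hr] at hlt hx
  set E := (uniformError α r).toReal
  set e0 := (0 : ℝ) ^ (1 - α) - ratEval r 0 with he0
  have hab := abs_le.1 (abs_error_le hα1 hfin (t := 0) (by simp))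
  suffices h : σ * e0 = E by
    rcases hσ with rfl | rfl
    · left; linarith
    · right; linarith
  by_contra hne
  have hlt0 : σ * e0 < E := by
    refine lt_of_le_of_ne ?_ hne
    rcases hσ with rfl | rfl <;> linarith [hab.1, hab.2]
  have hx0 : 0 < x 0 := by
    obtain ⟨h1, h2⟩ := hx 0 (by omega)
    refine lt_of_le_of_ne h1.1 fun h => hne ?_
    rw [← h] at h2
    simpa using h2
  -- A level `c` strictly between `max (σ e0) 0` and `E` makes `σ e - c` negative at `0` while
  -- keeping the signs at the `x i`. With `0` prepended there are `2k + 3` alternating points; the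
  -- sign of `σ` is flipped so that the chain starts positive.
  obtain ⟨c, hc, hcE⟩ := exists_between (max_lt hlt0 hE)
  obtain ⟨hc1, hc0⟩ := max_lt_iff.1 hc
  refine not_alternating_error_sub_const hα0 hα1 hfin (natDegree_num_le hr.1)
    (natDegree_denom_le hr.1) (σ := -σ) (by rcases hσ with rfl | rfl <;> norm_num) (-c)
    (fun i => Nat.casesOn i 0 x) (fun i hi => ?_) fun i hi => ?_
  · cases i with
    | zero => exact hx0
    | succ j => exact hlt j (by omega)
  · cases i with
    | zero =>
      refine ⟨by simp, ?_⟩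
      change 0 < (-1) ^ 0 * (-σ * e0 - -c)
      rw [pow_zero]
      linarith
    | succ j =>
      obtain ⟨h1, h2⟩ := hx j (by omega)
      refine ⟨h1, ?_⟩
      change 0 < (-1) ^ (j + 1) * (-σ * (x j ^ (1 - α) - ratEval r (x j)) - -c)
      have h3 : (-1 : ℝ) ^ (j + 1) * (-σ * (x j ^ (1 - α) - ratEval r (x j)) - -c) =
          E - (-1) ^ j * c := by
        rw [← h2]; ring
      rw [h3]
      rcases neg_one_pow_eq_or ℝ j with h | h <;> rw [h] <;> linarith

lemma not_rpow_le_mul {β : ℝ} (hβ : β < 1) (L : ℝ) :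
    ¬ ∀ t ∈ Icc (0 : ℝ) 1, t ^ β ≤ L * t := by
  intro h
  have hlim : Tendsto (fun t : ℝ => L * t ^ (1 - β)) (𝓝[>] 0) (𝓝 0) := by
    have h1 : ContinuousAt (fun t : ℝ => L * t ^ (1 - β)) 0 :=
      (continuous_const.mul (Real.continuous_rpow_const (by linarith))).continuousAt
    have h2 := h1.tendsto.mono_left (nhdsWithin_le_nhds (s := Ioi 0))
    rwa [Real.zero_rpow (by linarith), mul_zero] at h2
  have hmem : ∀ᶠ t in 𝓝[>] (0 : ℝ), t ∈ Ioo (0 : ℝ) 1 := Ioo_mem_nhdsGT zero_lt_one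
  obtain ⟨t, ht, ht1, ht2⟩ := ((hlim.eventually_lt_const one_pos).and hmem).exists
  have h3 := h t ⟨ht1.le, ht2.le⟩
  have h4 : t = t ^ β * t ^ (1 - β) := by
    rw [← Real.rpow_add ht1]; simp
  have h5 : 0 < t ^ β := Real.rpow_pos_of_pos ht1 _
  have h6 : t ^ β ≤ t ^ β * (L * t ^ (1 - β)) := by
    calc t ^ β ≤ L * t := h3
      _ = _ := by nth_rewrite 1 [h4]; ring
  nlinarith

end BURA

theorem lemma2p1 (α : ℝ) (hα0 : 0 < α) (hα1 : α < 1) (k : ℕ) (hk : 1 ≤ k)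
    (r : RatFunc ℝ) (hr : BURA.IsBURA α k k r) :
    StrictMonoOn (BURA.ratEval r) (Set.Icc 0 1) ∧
      ConcaveOn ℝ (Set.Icc 0 1) (BURA.ratEval r) ∧
      BURA.ratEval r 0 = BURA.minimaxError α k k := by
  obtain ⟨R, c, a, hR, hneg, ha, heq⟩ :=
    BURA.exists_ratEval_eq_partial_fractions hα0 hα1 hk hr
  obtain ⟨hmono, hconc⟩ := BURA.strictMonoOn_concaveOn_partial_fractions R c a hR hneg ha
  have hEq : Set.EqOn (fun t => c - ∑ x ∈ R, a x / (t - x)) (BURA.ratEval r) (Set.Icc 0 1) :=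
    fun t ht => (heq t ht.1).symm
  refine ⟨hmono.congr hEq, hconc.congr hEq, ?_⟩
  rw [BURA.minimaxError_eq hr]
  have hfin := BURA.uniformError_ne_top hα1 hr
  have h0 : (0 : ℝ) ^ (1 - α) = 0 := Real.zero_rpow (by linarith)
  rcases BURA.error_zero_eq hα0 hα1 hr with h | h
  -- If the error at `0` is `+E`, then `t ^ β - r(t) ≤ E = -r(0)`, so `t ^ β ≤ r(t) - r(0) ≤ L t`.
  · exfalso
    obtain ⟨L, hL⟩ := BURA.exists_partial_fractions_sub_le R c a hneg ha
    refine BURA.not_rpow_le_mul (β := 1 - α) (by linarith) L fun t ht => ?_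
    have h1 := (abs_le.1 (BURA.abs_error_le hα1 hfin ht)).2
    have h2 := hL t ht.1
    rw [← heq t ht.1, ← heq 0 le_rfl] at h2
    linarith
  · linarith
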